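/- Let $\alpha\in\mathbb R$ and put $\varepsilon_i(\alpha)=(-1)^i\frac{\Gamma(\alpha+1)}{i!\,\Gamma(\alpha-i+1)}=(-1)^i\frac{\alpha(\alpha-1)\cdots(\alpha-i+1)}{i!}$ for $i\ge 0$ (the last expression is used where the Gamma functions have poles). For a complex sequence $x=(x_k)_{k\ge0}$ let $(\Delta^{(\alpha)}x)_n=\sum_{i=0}^{n}\varepsilon_i(\alpha)x_{n-i}$, and let $c(\Delta^{(\alpha)})$ be the space of all complex sequences $x$ for which $\Delta^{(\alpha)}x$ converges, with the norm $\|x\|=\sup_n|(\Delta^{(\alpha)}x)_n|$. Let $s_{jk}=\varepsilon_{j-k}(-\alpha)$ for $0\le k\le j$ and $s_{jk}=0$ for $k>j$ (the inverse of the matrix of $\Delta^{(\alpha)}$). Let $c_0$, $c$, $\ell_\infty$ be the spaces of null, convergent and bounded complex sequences with the supremum norm. For sets $X,Y$ of complex sequences, $(X,Y)$ is the class of infinite complex matrices $A=(a_{nk})_{n,k\ge0}$ such that for every $x\in X$ all series $\sum_k a_{nk}x_k$ converge and $Ax=(\sum_k a_{nk}x_k)_n\in Y$; then $L_A\colon X\to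 Y$, $L_A(x)=Ax$. For a matrix $A$ put $$\hat a_{nk}=\sum_{j=k}^{\infty}s_{jk}a_{nj},\qquad w^{(A_n)}_{mk}=\sum_{j=m}^{\infty}s_{jk}a_{nj}\ (0\le k\le m),\qquad \gamma_n=\lim_{m\to\infty}\sum_{k=0}^{m}w^{(A_n)}_{mk},$$ $$\hat\alpha_k=\lim_{n\to\infty}\hat a_{nk},\qquad \beta=\lim_{n\to\infty}\Bigl(\sum_{k=0}^\infty\hat a_{nk}-\gamma_n\Bigr).$$ If $A$ is in $(c(\Delta^{(\alpha)}),Y)$ for some set $Y$ of complex sequences, then all the series $\hat a_{nk}$ and all the limits $\gamma_n$ exist, and $\sum_k|\hat a_{nk}|<\infty$ for each $n$. Moreover: (i) If $A\in(c(\Delta^{(\alpha)}),c_0)$, then $L_A$ is compact if and only if $$\lim_{r\to\infty}\sup_{n\ge r}\Bigl(\sum_{k=0}^\infty|\hat a_{nk}|+|\gamma_n|\Bigr)=0.\qquad(*)$$ (ii) If $A\in(c(\Delta^{(\alpha)}),c)$, then the limits $\hat\alpha_k$ and $\beta$ exist, $\sum_k|\hat\alpha_k|<\infty$, and $L_A$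 is compact if and only if $$\lim_{r\to\infty}\sup_{n\ge r}\Bigl(\sum_{k=0}^\infty|\hat a_{nk}-\hat\alpha_k|+\Bigl|\sum_{k=0}^\infty\hat\alpha_k-\gamma_n-\beta\Bigr|\Bigr)=0.$$ (iii) If $A\in(c(\Delta^{(\alpha)}),\ell_\infty)$ and $(*)$ holds, then $L_A$ is compact. -/

import Mathlib

open Filter Topology
open scoped ENNReal

noncomputable section

/-! ### The fractional difference matrix -/

/-- The coefficient `(-1)^i Γ(α+1) / (i! Γ(α-i+1)) = (-1)^i α(α-1)⋯(α-i+1) / i!`. It is written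
with the generalized binomial coefficient, so that it makes sense for every real `α`. -/
def fracCoeff (α : ℝ) (i : ℕ) : ℝ := (-1) ^ i * Ring.choose α i

/-- The matrix of the fractional difference operator of order `α`. -/
def fracMatrix (α : ℝ) (n k : ℕ) : ℂ := if k ≤ n then (fracCoeff α (n - k) : ℂ) else 0

theorem fracCoeff_zero (α : ℝ) : fracCoeff α 0 = 1 := by simp [fracCoeff]

/-- The coefficients are the ones given by the Gamma function wherever `Γ(α+1)` is defined
(the value of `1 / Γ` at a pole of `Γ` being `0`). -/
theorem fracCoeff_eq_Gamma (α : ℝ) (hα : ∀ m : ℕ, α + 1 ≠ -m) (i : ℕ) :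
    fracCoeff α i =
      (-1) ^ i * (Real.Gamma (α + 1) / (i.factorial * Real.Gamma (α - i + 1))) := by
  have key : ∀ i : ℕ, (i.factorial : ℝ) * Ring.choose α i =
      Real.Gamma (α + 1) / Real.Gamma (α - i + 1) := by
    intro i
    have e : ∀ i : ℕ, (i.factorial : ℝ) * Ring.choose α i = (descPochhammer ℝ i).eval α := by
      intro i
      rw [← nsmul_eq_mul, ← Ring.descPochhammer_eq_factorial_smul_choose,
        ← Polynomial.aeval_eq_smeval, Polynomial.aeval_def, Polynomial.eval₂_eq_eval_map,
        descPochhammer_map]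
    rw [e]
    induction i with
    | zero => simp [div_self (Real.Gamma_ne_zero hα)]
    | succ i ih =>
      rw [descPochhammer_succ_right, Polynomial.eval_mul, ih]
      have h1 : α - ((i + 1 : ℕ) : ℝ) + 1 = α - i := by push_cast; ring
      rw [h1]
      by_cases h : α - i = 0
      · simp [h]
      · rw [Real.Gamma_add_one h]
        simp only [Polynomial.eval_sub, Polynomial.eval_X, Polynomial.eval_natCast]
        field_simp
  have hi : (i.factorial : ℝ) ≠ 0 := by exact_mod_cast i.factorial_ne_zero
  rw [fracCoeff, mul_comm (i.factorial : ℝ), ← div_div, ← key i]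
  field_simp

/-- The `α`-transform `y_n = ∑_{i=0}^{n} (-1)^i Γ(α+1) / (i! Γ(α-i+1)) x_{n-i}` of a sequence
(terms with a negative index are zero). -/
def fracDiff (α : ℝ) : (ℕ → ℂ) →ₗ[ℂ] (ℕ → ℂ) where
  toFun x n := ∑ k ∈ Finset.range (n + 1), fracMatrix α n k * x k
  map_add' x y := by ext n; simp [mul_add, Finset.sum_add_distrib]
  map_smul' a x := by ext n; simp [Finset.mul_sum, mul_left_comm]

theorem fracDiff_injective (α : ℝ) : Function.Injective (fracDiff α) := by
  refine (injective_iff_map_eq_zero _).2 fun x hx => funext fun n => ?_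
  induction n using Nat.strong_induction_on with
  | _ n ih =>
    have h : ∑ k ∈ Finset.range (n + 1), fracMatrix α n k * x k = 0 := congrFun hx n
    rw [Finset.sum_range_succ, Finset.sum_eq_zero] at h
    · simpa [fracMatrix, fracCoeff_zero] using h
    · intro k hk
      rw [ih k (Finset.mem_range.1 hk)]
      simp

/-! ### Sequence spaces -/

/-- The space of bounded complex sequences with the supremum norm. -/
abbrev EllInfty : Type := lp (fun _ : ℕ => ℂ) ∞

/-- The convergent sequences, as a subspace of the bounded ones. -/
def cSpace : Submodule ℂ EllInfty where
  carrier := {z | ∃ l : ℂ, Tendsto (fun n => z n) atTop (𝓝 l)}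
  zero_mem' := ⟨0, by simp⟩
  add_mem' := by
    rintro y z ⟨l, hl⟩ ⟨l', hl'⟩
    exact ⟨l + l', by simpa using hl.add hl'⟩
  smul_mem' := by
    rintro a z ⟨l, hl⟩
    exact ⟨a * l, by simpa using hl.const_mul a⟩

/-- The null sequences, as a subspace of the bounded ones. -/
def cZeroSpace : Submodule ℂ EllInfty where
  carrier := {z | Tendsto (fun n => z n) atTop (𝓝 0)}
  zero_mem' := by simp
  add_mem' := by
    intro y z hl hl'
    have h := Tendsto.add (show Tendsto (fun n => y n) atTop (𝓝 0) from hl)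
      (show Tendsto (fun n => z n) atTop (𝓝 0) from hl')
    simpa using h
  smul_mem' := by
    intro a z hl
    have h := Tendsto.const_mul a (show Tendsto (fun n => z n) atTop (𝓝 0) from hl)
    simpa using h

/-- The set of sequences underlying a subspace of the bounded sequences. -/
def seqs (Y : Submodule ℂ EllInfty) : Set (ℕ → ℂ) := {y | ∃ z ∈ Y, ∀ n, z n = y n}

theorem memℓp_of_tendsto {y : ℕ → ℂ} {l : ℂ} (h : Tendsto y atTop (𝓝 l)) : Memℓp y ∞ :=
  memℓp_infty h.norm.bddAbove_range

theorem mem_seqs_cSpace (y : ℕ → ℂ) : y ∈ seqs cSpace ↔ ∃ l, Tendsto y atTop (𝓝 l) := by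
  constructor
  · rintro ⟨z, ⟨l, hl⟩, hz⟩
    exact ⟨l, by simpa only [hz] using hl⟩
  · rintro ⟨l, hl⟩
    exact ⟨⟨y, memℓp_of_tendsto hl⟩, ⟨l, hl⟩, fun n => rfl⟩

theorem mem_seqs_cZeroSpace (y : ℕ → ℂ) : y ∈ seqs cZeroSpace ↔ Tendsto y atTop (𝓝 0) := by
  constructor
  · rintro ⟨z, hl, hz⟩
    have h : Tendsto (fun n => z n) atTop (𝓝 0) := hl
    simpa only [hz] using h
  · intro hl
    exact ⟨⟨y, memℓp_of_tendsto hl⟩, hl, fun n => rfl⟩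

theorem mem_seqs_top (y : ℕ → ℂ) : y ∈ seqs ⊤ ↔ ∃ C : ℝ, ∀ n, ‖y n‖ ≤ C := by
  constructor
  · rintro ⟨z, -, hz⟩
    exact ⟨‖z‖, fun n => hz n ▸ lp.norm_apply_le_norm (by simp) z n⟩
  · rintro ⟨C, hC⟩
    exact ⟨⟨y, memℓp_infty ⟨C, by rintro _ ⟨n, rfl⟩; exact hC n⟩⟩, trivial, fun n => rfl⟩

/-- The sequences whose `α`-transform converges, as a subspace of the space of all sequences. -/
def fracConv (α : ℝ) : Submodule ℂ (ℕ → ℂ) where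
  carrier := {x | ∃ l : ℂ, Tendsto (fracDiff α x) atTop (𝓝 l)}
  zero_mem' := ⟨0, by rw [map_zero]; exact tendsto_const_nhds⟩
  add_mem' := by
    rintro x y ⟨l, hl⟩ ⟨l', hl'⟩
    exact ⟨l + l', by rw [map_add]; exact hl.add hl'⟩
  smul_mem' := by
    rintro a x ⟨l, hl⟩
    exact ⟨a * l, by rw [map_smul]; exact hl.const_mul a⟩

/-- The space of sequences with convergent `α`-transform as a type of its own; it is normed by
`‖x‖ = sup_n |(fracDiff α x)_n|`, not by the topology of coordinatewise convergence. -/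
def FracC (α : ℝ) : Type := ↥(fracConv α)

namespace FracC

instance (α : ℝ) : AddCommGroup (FracC α) := inferInstanceAs (AddCommGroup ↥(fracConv α))

instance (α : ℝ) : Module ℂ (FracC α) := inferInstanceAs (Module ℂ ↥(fracConv α))

/-- The inclusion into the space of all sequences. -/
def toSeq (α : ℝ) : FracC α →ₗ[ℂ] (ℕ → ℂ) := (fracConv α).subtype

theorem toSeq_mem {α : ℝ} (x : FracC α) : toSeq α x ∈ fracConv α := Subtype.prop x

/-- The `α`-transform as a map to the bounded sequences. -/
def transform (α : ℝ) : FracC α →ₗ[ℂ] EllInfty where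
  toFun x := ⟨fracDiff α (toSeq α x), memℓp_of_tendsto (toSeq_mem x).choose_spec⟩
  map_add' x y := by
    apply Subtype.ext
    change fracDiff α (toSeq α (x + y)) = fracDiff α (toSeq α x) + fracDiff α (toSeq α y)
    rw [map_add, map_add]
  map_smul' a x := by
    apply Subtype.ext
    change fracDiff α (toSeq α (a • x)) = a • fracDiff α (toSeq α x)
    rw [map_smul, map_smul]

theorem transform_injective (α : ℝ) : Function.Injective (transform α) := by
  intro x y h
  have h' : fracDiff α (toSeq α x) = fracDiff α (toSeq α y) := congrArg Subtype.val h
  exact Subtype.ext (fracDiff_injective α h')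

instance (α : ℝ) : NormedAddCommGroup (FracC α) :=
  NormedAddCommGroup.induced (FracC α) EllInfty (transform α) (transform_injective α)

instance (α : ℝ) : NormedSpace ℂ (FracC α) := NormedSpace.induced ℂ (FracC α) EllInfty (transform α)

theorem norm_eq {α : ℝ} (x : FracC α) : ‖x‖ = ⨆ n, ‖fracDiff α (toSeq α x) n‖ :=
  lp.norm_eq_ciSup (transform α x)

end FracC

/-! ### Matrix transformations

All infinite series `∑_k a_{nk} x_k` are limits of their partial sums, which is what summation with
respect to `SummationFilter.conditional ℕ` means. -/

/-- `A x = (∑_k a_{nk} x_k)_n`. -/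
def matrixApply (A : ℕ → ℕ → ℂ) (x : ℕ → ℂ) (n : ℕ) : ℂ :=
  ∑'[SummationFilter.conditional ℕ] k, A n k * x k

/-- The class `(X, Y)` of the infinite matrices that map `X` into `Y`. -/
def MatrixClass (X Y : Set (ℕ → ℂ)) : Set (ℕ → ℕ → ℂ) :=
  {A | ∀ x ∈ X, (∀ n, Summable (fun k => A n k * x k) (SummationFilter.conditional ℕ)) ∧
    matrixApply A x ∈ Y}

/-- The operator `L_A : x ↦ A x` that a matrix `A` of the class `(c(Δ^(α)), Y)` defines. -/
def matrixOperator {α : ℝ} {Y : Submodule ℂ EllInfty} {A : ℕ → ℕ → ℂ}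
    (hA : A ∈ MatrixClass (fracConv α) (seqs Y)) : FracC α →ₗ[ℂ] Y where
  toFun x := ⟨(hA _ (FracC.toSeq_mem x)).2.choose, (hA _ (FracC.toSeq_mem x)).2.choose_spec.1⟩
  map_add' x y := by
    apply Subtype.ext
    apply lp.ext
    funext n
    have hx := hA _ (FracC.toSeq_mem x)
    have hy := hA _ (FracC.toSeq_mem y)
    have hxy := hA _ (FracC.toSeq_mem (x + y))
    change hxy.2.choose n = hx.2.choose n + hy.2.choose n
    rw [hxy.2.choose_spec.2, hx.2.choose_spec.2, hy.2.choose_spec.2]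
    simp only [matrixApply, map_add, Pi.add_apply, mul_add]
    exact (hx.1 n).tsum_add (hy.1 n)
  map_smul' a x := by
    apply Subtype.ext
    apply lp.ext
    funext n
    have hx := hA _ (FracC.toSeq_mem x)
    have hax := hA _ (FracC.toSeq_mem (a • x))
    change hax.2.choose n = a * hx.2.choose n
    rw [hax.2.choose_spec.2, hx.2.choose_spec.2]
    simp only [matrixApply, map_smul, Pi.smul_apply, smul_eq_mul, mul_left_comm _ a]
    exact tsum_mul_left

theorem matrixOperator_apply {α : ℝ} {Y : Submodule ℂ EllInfty} {A : ℕ → ℕ → ℂ}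
    (hA : A ∈ MatrixClass (fracConv α) (seqs Y)) (x : FracC α) (n : ℕ) :
    (matrixOperator hA x : EllInfty) n = matrixApply A (FracC.toSeq α x) n :=
  (hA _ (FracC.toSeq_mem x)).2.choose_spec.2 n

/-! ### The data associated with a matrix

Below `s = fracMatrix (-α)` is the inverse of the triangle `fracMatrix α`. -/

/-- `â_{nk} = ∑_{j ≥ k} s_{jk} a_{nj}` (note that `s_{jk} = 0` for `j < k`). -/
def hatMatrix (α : ℝ) (A : ℕ → ℕ → ℂ) (n k : ℕ) : ℂ :=
  ∑'[SummationFilter.conditional ℕ] j, fracMatrix (-α) j k * A n j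

/-- `w^{(A_n)}_{mk} = ∑_{j ≥ m} s_{jk} a_{nj}` for `k ≤ m`, and `0` for `k > m`. -/
def wMatrix (α : ℝ) (A : ℕ → ℕ → ℂ) (n m k : ℕ) : ℂ :=
  if k ≤ m then ∑'[SummationFilter.conditional ℕ] i, fracMatrix (-α) (m + i) k * A n (m + i)
  else 0

/-- `γ_n = lim_m ∑_{k=0}^{m} w^{(A_n)}_{mk}`. -/
def gammaSeq (α : ℝ) (A : ℕ → ℕ → ℂ) (n : ℕ) : ℂ :=
  limUnder atTop fun m => ∑ k ∈ Finset.range (m + 1), wMatrix α A n m k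

/-- `α̂_k = lim_n â_{nk}`. -/
def hatLimit (α : ℝ) (A : ℕ → ℕ → ℂ) (k : ℕ) : ℂ :=
  limUnder atTop fun n => hatMatrix α A n k

/-- `β = lim_n (∑_k â_{nk} - γ_n)`. -/
def betaLimit (α : ℝ) (A : ℕ → ℕ → ℂ) : ℂ :=
  limUnder atTop fun n => (∑' k, hatMatrix α A n k) - gammaSeq α A n

end

noncomputable section

/-! ### Conditional summation over `ℕ` -/

/-! The transform `y = fracDiff α x` is an isometry of c(Δ^(α)) onto c, with inverse `fracDiff
(-α)`. Carried over to c, the n-th row of A becomes the functional `y ↦ ∑ â_nk y_k - γ_n lim y`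
(`row_representation`), whose norm is `∑ |â_nk| + |γ_n|` (`norm_tsum_mul_sub_le`,
`tsum_norm_add_norm_le`).

If the target consists of convergent sequences, an operator into it is compact exactly when the
coordinates of the images converge uniformly on the unit ball (`IsCompactOperator.uniform_tendsto`,
`isCompactOperator_of_uniform_cauchy`). The limit of the coordinates is a functional of the same
shape with coefficients `h` and `d`: both zero for c_0, and `h = α̂`, `d = ∑ α̂_k - β` for c. The
norm of the difference between the n-th coordinate and this limit is the quantity in the criterion.
In ℓ_∞ the coordinates need not converge, so only sufficiency remains. -/

theorem hasSum_conditional_nat_iff {f : ℕ → ℂ} {a : ℂ} :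
    HasSum f a (SummationFilter.conditional ℕ) ↔
      Tendsto (fun n => ∑ k ∈ Finset.range n, f k) atTop (𝓝 a) := by
  rw [HasSum, SummationFilter.conditional_filter_eq_map_range, tendsto_map'_iff]
  rfl

theorem summable_conditional_nat_iff {f : ℕ → ℂ} :
    Summable f (SummationFilter.conditional ℕ) ↔
      ∃ a, Tendsto (fun n => ∑ k ∈ Finset.range n, f k) atTop (𝓝 a) :=
  exists_congr fun _ => hasSum_conditional_nat_iff

/-! ### Functionals `y ↦ ∑ b_k y_k - g lim y` on the convergent sequences -/

theorem exists_norm_le_one_mul_eq_norm (z : ℂ) : ∃ u : ℂ, ‖u‖ ≤ 1 ∧ z * u = ‖z‖ := by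
  by_cases hz : z = 0
  · exact ⟨0, by simp, by simp [hz]⟩
  · have h : (‖z‖ : ℂ) ≠ 0 := by simpa using hz
    refine ⟨(starRingEnd ℂ) z / ‖z‖, ?_, ?_⟩
    · rw [norm_div, RCLike.norm_conj, Complex.norm_real, norm_norm]
      exact div_self_le_one _
    · rw [← mul_div_assoc, Complex.mul_conj, Complex.normSq_eq_norm_sq]
      field_simp
      push_cast
      ring

theorem summable_mul_of_bounded {b y : ℕ → ℂ} {C : ℝ} (hb : Summable b) (hy : ∀ k, ‖y k‖ ≤ C) :
    Summable fun k => b k * y k := by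
  refine Summable.of_norm_bounded (hb.norm.mul_right C) fun k => ?_
  rw [norm_mul]
  exact mul_le_mul_of_nonneg_left (hy k) (norm_nonneg _)

theorem norm_tsum_mul_le {b y : ℕ → ℂ} {C : ℝ} (hb : Summable b) (hy : ∀ k, ‖y k‖ ≤ C) :
    ‖∑' k, b k * y k‖ ≤ (∑' k, ‖b k‖) * C := by
  rw [← tsum_mul_right]
  refine tsum_of_norm_bounded (hb.norm.mul_right C).hasSum fun k => ?_
  rw [norm_mul]
  exact mul_le_mul_of_nonneg_left (hy k) (norm_nonneg _)

theorem norm_tsum_mul_sub_le {b y : ℕ → ℂ} {g l : ℂ} {C : ℝ} (hb : Summable b)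
    (hy : ∀ k, ‖y k‖ ≤ C) (hl : Tendsto y atTop (𝓝 l)) :
    ‖(∑' k, b k * y k) - g * l‖ ≤ ((∑' k, ‖b k‖) + ‖g‖) * C := by
  have h : ‖l‖ ≤ C := le_of_tendsto hl.norm (Eventually.of_forall hy)
  rw [add_mul]
  refine (norm_sub_le _ _).trans (add_le_add (norm_tsum_mul_le hb hy) ?_)
  rw [norm_mul]
  exact mul_le_mul_of_nonneg_left h (norm_nonneg _)

theorem tsum_norm_add_norm_le {b : ℕ → ℂ} {g : ℂ} {C : ℝ} (hb : Summable b)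
    (h : ∀ (y : ℕ → ℂ) (l : ℂ), Tendsto y atTop (𝓝 l) → (∀ k, ‖y k‖ ≤ 1) →
      ‖(∑' k, b k * y k) - g * l‖ ≤ C) :
    (∑' k, ‖b k‖) + ‖g‖ ≤ C := by
  choose u hu hbu using fun k => exists_norm_le_one_mul_eq_norm (b k)
  obtain ⟨v, hv, hgv⟩ := exists_norm_le_one_mul_eq_norm g
  -- The test sequence has the optimal phases up to N and limit `-v`, so that `-g * l` contributes
  -- `+‖g‖`. The leftover tail of `b` vanishes as N grows.
  have hy : ∀ N k, ‖if k < N then u k else -v‖ ≤ 1 := fun N k => by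
    split_ifs
    exacts [hu k, by simpa using hv]
  have key : ∀ N : ℕ, ‖((∑ k ∈ Finset.range N, ‖b k‖ : ℝ) : ℂ)
      - (∑' k, b (k + N)) * v + ‖g‖‖ ≤ C := by
    intro N
    have hl : Tendsto (fun k => if k < N then u k else -v) atTop (𝓝 (-v)) :=
      tendsto_const_nhds.congr' <| by
        filter_upwards [eventually_ge_atTop N] with k hk
        rw [if_neg (by lia)]
    convert h _ _ hl (hy N) using 2
    rw [← (summable_mul_of_bounded hb (hy N)).sum_add_tsum_nat_add N, ← tsum_mul_right, ← hgv]
    have h1 : ∑ k ∈ Finset.range N, b k * (if k < N then u k else -v) =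
        ((∑ k ∈ Finset.range N, ‖b k‖ : ℝ) : ℂ) := by
      rw [Complex.ofReal_sum]
      refine Finset.sum_congr rfl fun k hk => ?_
      rw [if_pos (Finset.mem_range.1 hk), hbu]
    rw [h1]
    simp [tsum_neg]
    ring
  have hlim : Tendsto (fun N => ‖((∑ k ∈ Finset.range N, ‖b k‖ : ℝ) : ℂ)
      - (∑' k, b (k + N)) * v + ‖g‖‖) atTop
      (𝓝 ‖((∑' k, ‖b k‖ : ℝ) : ℂ) - 0 * v + ‖g‖‖) :=
    ((((Complex.continuous_ofReal.tendsto _).comp hb.norm.hasSum.tendsto_sum_nat).sub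
      ((tendsto_sum_nat_add b).mul_const v)).add_const _).norm
  have := le_of_tendsto hlim (Eventually.of_forall key)
  rw [zero_mul, sub_zero, ← Complex.ofReal_add, Complex.norm_real, Real.norm_of_nonneg] at this
  · exact this
  · exact add_nonneg (tsum_nonneg fun _ => norm_nonneg _) (norm_nonneg _)

/-- Uniform boundedness for families of absolutely summable sequences acting on the null
sequences. -/
theorem exists_bound_tsum_norm {ι : Type*} {b : ι → ℕ → ℂ} (hb : ∀ i, Summable (b i))
    (h : ∀ y : ℕ → ℂ, Tendsto y atTop (𝓝 0) → ∃ C : ℝ, ∀ i, ‖∑' k, b i k * y k‖ ≤ C) :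
    ∃ C : ℝ, ∀ i, ∑' k, ‖b i k‖ ≤ C := by
  have hle : ∀ (y : ZeroAtInftyContinuousMap ℕ ℂ) (k : ℕ), ‖y k‖ ≤ ‖y‖ := fun y k =>
    y.toBCF.norm_coe_le_norm k
  let F : ι → ZeroAtInftyContinuousMap ℕ ℂ →L[ℂ] ℂ := fun i => LinearMap.mkContinuous
    { toFun := fun y => ∑' k, b i k * y k
      map_add' := fun y z => by
        simp only [ZeroAtInftyContinuousMap.add_apply, mul_add]
        exact (summable_mul_of_bounded (hb i) (hle y)).tsum_add
          (summable_mul_of_bounded (hb i) (hle z))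
      map_smul' := fun a y => by
        simp only [ZeroAtInftyContinuousMap.smul_apply, smul_eq_mul, mul_left_comm _ a,
          tsum_mul_left, RingHom.id_apply] }
    (∑' k, ‖b i k‖) fun y => norm_tsum_mul_le (hb i) (hle y)
  obtain ⟨C, hC⟩ := banach_steinhaus (g := F) fun y => h y <| by
    have := y.zero_at_infty'
    rwa [cocompact_eq_cofinite, Nat.cofinite_eq_atTop] at this
  refine ⟨C, fun i => (hb i).norm.tsum_le_of_sum_range_le fun N => ?_⟩
  choose u hu hbu using fun k => exists_norm_le_one_mul_eq_norm (b i k)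
  -- Truncated phases: a null sequence in the unit ball at which `F i` takes the value of a partial
  -- sum of `∑ ‖b i k‖`.
  let y : ZeroAtInftyContinuousMap ℕ ℂ :=
    { toFun := fun k => if k < N then u k else 0
      continuous_toFun := continuous_of_discreteTopology
      zero_at_infty' := by
        rw [cocompact_eq_cofinite, Nat.cofinite_eq_atTop]
        refine tendsto_const_nhds.congr' ?_
        filter_upwards [eventually_ge_atTop N] with k hk
        rw [if_neg (by lia)] }
  have hyk : ∀ k, y k = if k < N then u k else 0 := fun k => rfl
  have hy : ‖y‖ ≤ 1 := by
    rw [← ZeroAtInftyContinuousMap.norm_toBCF_eq_norm]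
    refine (BoundedContinuousFunction.norm_le zero_le_one).2 fun k => ?_
    change ‖if k < N then u k else 0‖ ≤ 1
    split_ifs
    exacts [hu k, by simp]
  have hF : F i y = ((∑ k ∈ Finset.range N, ‖b i k‖ : ℝ) : ℂ) := by
    change ∑' k, b i k * y k = _
    rw [tsum_eq_sum (s := Finset.range N), Complex.ofReal_sum]
    · refine Finset.sum_congr rfl fun k hk => ?_
      rw [hyk, if_pos (Finset.mem_range.1 hk), hbu]
    · intro k hk
      rw [hyk, if_neg (by simpa using hk), mul_zero]
  have h1 : ‖F i y‖ ≤ C :=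
    ((F i).le_of_opNorm_le_of_le (hC i) hy).trans_eq (mul_one C)
  rw [hF, Complex.norm_real] at h1
  exact (le_abs_self _).trans h1

/-- Fatou's lemma for series: the bound passes to the limit in each finite partial sum. -/
theorem summable_of_tendsto_of_bound {b : ℕ → ℕ → ℂ} {h : ℕ → ℂ} {C : ℝ}
    (hb : ∀ n, Summable (b n)) (hC : ∀ n, ∑' k, ‖b n k‖ ≤ C)
    (hlim : ∀ k, Tendsto (fun n => b n k) atTop (𝓝 (h k))) :
    Summable h ∧ ∑' k, ‖h k‖ ≤ C := by
  have hN : ∀ N, ∑ k ∈ Finset.range N, ‖h k‖ ≤ C := fun N =>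
    le_of_tendsto (tendsto_finsetSum _ fun k _ => (hlim k).norm) <| Eventually.of_forall fun n =>
      ((hb n).norm.sum_le_tsum _ fun _ _ => norm_nonneg _).trans (hC n)
  have hs : Summable fun k => ‖h k‖ := summable_of_sum_range_le (fun _ => norm_nonneg _) hN
  exact ⟨hs.of_norm, hs.tsum_le_of_sum_range_le hN⟩

/-- A finite head converges coordinatewise; the tail is small uniformly in n, because `y` is small
there and the ℓ¹ norms are bounded. -/
theorem tendsto_tsum_mul_of_bound {b : ℕ → ℕ → ℂ} {h y : ℕ → ℂ} {C : ℝ}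
    (hb : ∀ n, Summable (b n)) (hC : ∀ n, ∑' k, ‖b n k‖ ≤ C)
    (hlim : ∀ k, Tendsto (fun n => b n k) atTop (𝓝 (h k))) (hy : Tendsto y atTop (𝓝 0)) :
    Tendsto (fun n => ∑' k, b n k * y k) atTop (𝓝 (∑' k, h k * y k)) := by
  obtain ⟨hs, hsC⟩ := summable_of_tendsto_of_bound hb hC hlim
  have hC0 : 0 ≤ C := (tsum_nonneg fun _ => norm_nonneg _).trans hsC
  obtain ⟨M, hM⟩ := hy.norm.bddAbove_range
  have hyM : ∀ k, ‖y k‖ ≤ M := fun k => hM ⟨k, rfl⟩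
  rw [Metric.tendsto_atTop]
  intro ε hε
  -- The differences `b n - h` have ℓ¹ norm at most `2 * C`, so this makes the tail less than `ε /
  -- 2`; the `+ 1` covers `C = 0`.
  obtain ⟨N, hN⟩ := Metric.tendsto_atTop.1 hy (ε / (4 * (C + 1))) (by positivity)
  have hfin : Tendsto (fun n => ∑ k ∈ Finset.range N, (b n k - h k) * y k) atTop (𝓝 0) := by
    have : Tendsto (fun n => ∑ k ∈ Finset.range N, (b n k - h k) * y k) atTop
        (𝓝 (∑ k ∈ Finset.range N, (h k - h k) * y k)) :=
      tendsto_finsetSum _ fun k _ => ((hlim k).sub_const _).mul_const _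
    simpa using this
  obtain ⟨n₀, hn₀⟩ := Metric.tendsto_atTop.1 hfin (ε / 2) (by positivity)
  refine ⟨n₀, fun n hn => ?_⟩
  have h1 := hn₀ n hn
  rw [dist_zero_right] at h1
  have hd : Summable fun k => b n k - h k := (hb n).sub hs
  have hdC : ∑' k, ‖b n k - h k‖ ≤ 2 * C := by
    refine (hd.norm.tsum_le_tsum (fun k => norm_sub_le _ _) ((hb n).norm.add hs.norm)).trans ?_
    rw [(hb n).norm.tsum_add hs.norm]
    linarith [hC n]
  rw [dist_eq_norm, ← (summable_mul_of_bounded (hb n) hyM).tsum_sub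
    (summable_mul_of_bounded hs hyM)]
  simp only [← sub_mul]
  rw [← (summable_mul_of_bounded hd hyM).sum_add_tsum_nat_add N]
  have h2 : ‖∑' k, (b n (k + N) - h (k + N)) * y (k + N)‖ ≤ 2 * C * (ε / (4 * (C + 1))) := by
    have hyN : ∀ k, ‖y (k + N)‖ ≤ ε / (4 * (C + 1)) := fun k => by
      simpa using (hN (k + N) (by lia)).le
    refine (norm_tsum_mul_le (b := fun k => b n (k + N) - h (k + N))
      ((summable_nat_add_iff (f := fun k => b n k - h k) N).2 hd) hyN).trans ?_
    refine mul_le_mul_of_nonneg_right (le_trans ?_ hdC) (by positivity)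
    rw [← hd.norm.sum_add_tsum_nat_add N]
    exact le_add_of_nonneg_left (Finset.sum_nonneg fun _ _ => norm_nonneg _)
  have h3 : 2 * C * (ε / (4 * (C + 1))) < ε / 2 := by
    rw [mul_div_assoc', div_lt_div_iff₀ (by positivity) (by positivity)]
    nlinarith
  exact (norm_add_le _ _).trans_lt (by linarith)

/-! ### Compactness of operators into spaces of bounded sequences -/

theorem isClosed_cSpace : IsClosed (cSpace : Set EllInfty) := by
  have hiff : ∀ z : EllInfty, z ∈ cSpace ↔ CauchySeq fun n => z n := fun z =>
    ⟨fun ⟨_, hl⟩ => hl.cauchySeq, fun h => cauchySeq_tendsto_of_complete h⟩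
  refine isClosed_of_closure_subset fun z hz => ?_
  refine (hiff z).2 (Metric.cauchySeq_iff'.2 fun ε hε => ?_)
  obtain ⟨w, hw, hzw⟩ := Metric.mem_closure_iff.1 hz (ε / 3) (by positivity)
  obtain ⟨N, hN⟩ := Metric.cauchySeq_iff'.1 ((hiff w).1 hw) (ε / 3) (by positivity)
  refine ⟨N, fun n hn => ?_⟩
  have h : ∀ k, dist (z k) (w k) < ε / 3 := fun k => by
    rw [dist_eq_norm] at hzw ⊢
    exact (lp.norm_apply_le_norm (by simp) (z - w) k).trans_lt hzw
  have h1 := h n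
  have h2 := h N
  have h3 := hN n hn
  rw [dist_comm] at h2
  linarith [dist_triangle4 (z n) (w n) (w N) (z N)]

theorem isClosed_cZeroSpace : IsClosed (cZeroSpace : Set EllInfty) := by
  refine isClosed_of_closure_subset fun z hz => ?_
  refine Metric.tendsto_atTop.2 fun ε hε => ?_
  obtain ⟨w, hw, hzw⟩ := Metric.mem_closure_iff.1 hz (ε / 2) (by positivity)
  obtain ⟨N, hN⟩ := Metric.tendsto_atTop.1 hw (ε / 2) (by positivity)
  refine ⟨N, fun n hn => ?_⟩
  have h : dist (z n) (w n) < ε / 2 := by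
    rw [dist_eq_norm] at hzw ⊢
    exact (lp.norm_apply_le_norm (by simp) (z - w) n).trans_lt hzw
  linarith [dist_triangle (z n) (w n) 0, hN n hn]

section Compact

variable {E : Type*} [SeminormedAddCommGroup E] [NormedSpace ℂ E] {Y : Submodule ℂ EllInfty}

/-- A compact operator maps the unit ball to a set whose elements converge uniformly. -/
theorem IsCompactOperator.uniform_tendsto (hY : Y ≤ cSpace) {L : E →ₗ[ℂ] Y}
    (hL : IsCompactOperator L) {ε : ℝ} (hε : 0 < ε) :
    ∃ r : ℕ, ∀ n ≥ r, ∀ x : E, ‖x‖ ≤ 1 → ∀ l : ℂ,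
      Tendsto (fun m => (L x : EllInfty) m) atTop (𝓝 l) → ‖(L x : EllInfty) n - l‖ ≤ ε := by
  have hK := (hL.isCompact_closure_image_closedBall (f := L) 1).totallyBounded.subset subset_closure
  obtain ⟨t, -, ht, hcov⟩ := Metric.finite_approx_of_totallyBounded hK (ε / 4) (by positivity)
  have hr : ∀ z : Y, ∀ᶠ r in atTop, ∀ n ≥ r, ∀ m ≥ r,
      dist ((z : EllInfty) n) ((z : EllInfty) m) < ε / 4 := by
    intro z
    obtain ⟨l, hl⟩ := hY z.2
    obtain ⟨r, hr⟩ := Metric.cauchySeq_iff.1 hl.cauchySeq (ε / 4) (by positivity)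
    filter_upwards [eventually_ge_atTop r] with s hs n hn m hm
    exact hr n (hs.trans hn) m (hs.trans hm)
  obtain ⟨r, hr⟩ := ((eventually_all_finite ht).2 fun z _ => hr z).exists
  refine ⟨r, fun n hn x hx l hl => ?_⟩
  obtain ⟨z, hz, hxz⟩ := Set.mem_iUnion₂.1 (hcov ⟨x, by simpa using hx, rfl⟩)
  have h : ∀ k, dist ((L x : EllInfty) k) ((z : EllInfty) k) < ε / 4 := fun k => by
    rw [Metric.mem_ball, Subtype.dist_eq, dist_eq_norm] at hxz
    rw [dist_eq_norm]
    exact (lp.norm_apply_le_norm (by simp) ((L x : EllInfty) - (z : EllInfty)) k).trans_lt hxz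
  -- The limit `l` is replaced by a late coordinate m; passing through the net element `z` costs
  -- three times `ε / 4`.
  refine le_of_tendsto (hl.const_sub _).norm ?_
  filter_upwards [eventually_ge_atTop r] with m hm
  rw [← dist_eq_norm]
  have h1 := h m
  rw [dist_comm] at h1
  linarith [dist_triangle4 ((L x : EllInfty) n) ((z : EllInfty) n) ((z : EllInfty) m)
    ((L x : EllInfty) m), h n, hr z hz n hn m hm]

/-- Up to a uniform error, an image of the unit ball is determined by its coordinates up to r, which
range over a bounded set in a finite-dimensional space. Thus the image of the ball is totally
bounded, and closedness of `Y` supplies completeness. -/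
theorem isCompactOperator_of_uniform_cauchy (hY : IsClosed (Y : Set EllInfty)) {L : E →ₗ[ℂ] Y}
    (hb : ∀ n, ∃ C : ℝ, ∀ x : E, ‖x‖ ≤ 1 → ‖(L x : EllInfty) n‖ ≤ C)
    (hc : ∀ ε > 0, ∃ r : ℕ, ∀ n ≥ r, ∀ x : E, ‖x‖ ≤ 1 →
      ‖(L x : EllInfty) n - (L x : EllInfty) r‖ ≤ ε) : IsCompactOperator L := by
  have := hY.completeSpace_coe
  rw [isCompactOperator_iff_isCompact_closure_image_closedBall L zero_lt_one]
  refine TotallyBounded.isCompact_of_isClosed (TotallyBounded.closure ?_) isClosed_closure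
  refine Metric.totallyBounded_of_finite_discretization fun ε hε => ?_
  obtain ⟨r, hr⟩ := hc (ε / 5) (by positivity)
  choose C hC using hb
  let P : Y → Fin (r + 1) → ℂ := fun z i => (z : EllInfty) i
  have hPb : TotallyBounded (P '' (L '' Metric.closedBall 0 1)) := by
    refine TotallyBounded.subset (s₂ := Set.pi Set.univ fun i : Fin (r + 1) =>
      Metric.closedBall (0 : ℂ) (C i)) ?_
      (isCompact_univ_pi fun i : Fin (r + 1) => isCompact_closedBall (0 : ℂ) (C i)).totallyBounded
    rintro _ ⟨_, ⟨x, hx, rfl⟩, rfl⟩ i _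
    simpa [P] using hC i x (by simpa using hx)
  -- Two images assigned to the same net point differ by less than `ε / 5` in the coordinates up to
  -- r, hence by at most `3 * (ε / 5)` in all coordinates.
  obtain ⟨t, -, ht, hcov⟩ := Metric.finite_approx_of_totallyBounded hPb (ε / 10) (by positivity)
  have hpick : ∀ z : (L '' Metric.closedBall 0 1 : Set Y), ∃ w : t, dist (P z) w < ε / 10 := by
    intro z
    obtain ⟨w, hw, hzw⟩ := Set.mem_iUnion₂.1 (hcov ⟨z, z.2, rfl⟩)
    exact ⟨⟨w, hw⟩, hzw⟩
  choose F hF using hpick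
  refine ⟨t, ht.fintype, F, ?_⟩
  rintro ⟨_, x, hx, rfl⟩ ⟨_, y, hy, rfl⟩ hxy
  have hxF := hF ⟨_, x, hx, rfl⟩
  have hyF := hF ⟨_, y, hy, rfl⟩
  rw [← hxy] at hyF
  have hP := dist_triangle_right (P (L x)) (P (L y)) (F ⟨_, x, hx, rfl⟩)
  have hsmall : ∀ n ≤ r, dist ((L x : EllInfty) n) ((L y : EllInfty) n) < ε / 5 := fun n hn =>
    (dist_le_pi_dist (P (L x)) (P (L y)) ⟨n, by lia⟩).trans_lt (by linarith)
  refine lt_of_le_of_lt (b := 3 * (ε / 5)) ?_ (by linarith)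
  rw [Subtype.dist_eq, dist_eq_norm]
  refine lp.norm_le_of_forall_le (by positivity) fun n => ?_
  change ‖(L x : EllInfty) n - (L y : EllInfty) n‖ ≤ _
  rw [← dist_eq_norm]
  rcases le_total n r with hn | hn
  · linarith [hsmall n hn]
  · have h1 := hr n hn x (by simpa using hx)
    have h2 := hr n hn y (by simpa using hy)
    rw [← dist_eq_norm] at h1 h2
    rw [dist_comm] at h2
    linarith [dist_triangle4 ((L x : EllInfty) n) ((L x : EllInfty) r) ((L y : EllInfty) r)
      ((L y : EllInfty) n), hsmall r le_rfl]

end Compact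

/-! ### The inverse of the fractional difference operator -/

theorem fracDiff_eq_coeff (α : ℝ) (x : ℕ → ℂ) (n : ℕ) :
    fracDiff α x n =
      PowerSeries.coeff n (PowerSeries.mk x * PowerSeries.mk fun i => (fracCoeff α i : ℂ)) := by
  rw [PowerSeries.coeff_mul, Finset.Nat.sum_antidiagonal_eq_sum_range_succ_mk]
  change ∑ k ∈ Finset.range (n + 1), fracMatrix α n k * x k = _
  refine Finset.sum_congr rfl fun k hk => ?_
  rw [fracMatrix, if_pos (Nat.lt_succ_iff.1 (Finset.mem_range.1 hk)), PowerSeries.coeff_mk,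
    PowerSeries.coeff_mk, mul_comm]

/-- The identity (1 - t)^(-α) (1 - t)^α = 1 for formal power series, proved by the Chu–Vandermonde
identity. -/
theorem mk_fracCoeff_mul_mk_fracCoeff_neg (α : ℝ) :
    PowerSeries.mk (fun i => (fracCoeff (-α) i : ℂ)) * PowerSeries.mk (fun i => (fracCoeff α i : ℂ))
      = 1 := by
  ext n
  rw [PowerSeries.coeff_mul]
  simp only [PowerSeries.coeff_mk, PowerSeries.coeff_one]
  have h : ∑ p ∈ Finset.HasAntidiagonal.antidiagonal n, fracCoeff (-α) p.1 * fracCoeff α p.2 =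
      if n = 0 then 1 else 0 := by
    have h0 := Ring.add_choose_eq n (Commute.all (-α) α)
    rw [neg_add_cancel] at h0
    calc _ = (-1) ^ n * Ring.choose (0 : ℝ) n := by
          rw [h0, Finset.mul_sum]
          refine Finset.sum_congr rfl fun p hp => ?_
          rw [← Finset.HasAntidiagonal.mem_antidiagonal.1 hp, fracCoeff, fracCoeff, pow_add]
          ring
      _ = _ := by
          rcases n with _ | n
          · simp
          · simp [Ring.choose_zero_succ]
  simpa [apply_ite (fun r : ℝ => (r : ℂ))] using congrArg (fun r : ℝ => (r : ℂ)) h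

theorem fracDiff_fracDiff_neg (α : ℝ) (y : ℕ → ℂ) : fracDiff α (fracDiff (-α) y) = y := by
  funext n
  have h : PowerSeries.mk (fracDiff (-α) y) =
      PowerSeries.mk y * PowerSeries.mk fun i => (fracCoeff (-α) i : ℂ) := by
    ext k
    rw [PowerSeries.coeff_mk, fracDiff_eq_coeff]
  rw [fracDiff_eq_coeff, h, mul_assoc, mk_fracCoeff_mul_mk_fracCoeff_neg, mul_one,
    PowerSeries.coeff_mk]

theorem fracDiff_neg_fracDiff (α : ℝ) (y : ℕ → ℂ) : fracDiff (-α) (fracDiff α y) = y := by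
  simpa using fracDiff_fracDiff_neg (-α) y

theorem fracDiff_neg_mem_fracConv {α : ℝ} {y : ℕ → ℂ} {l : ℂ} (hy : Tendsto y atTop (𝓝 l)) :
    fracDiff (-α) y ∈ fracConv α :=
  ⟨l, by rwa [fracDiff_fracDiff_neg]⟩

/-! ### The functional defined by a row of a matrix -/

theorem tsum_mul_sub_const {b y : ℕ → ℂ} {l : ℂ} (hb : Summable b) (hy : Tendsto y atTop (𝓝 l)) :
    ∑' k, b k * (y k - l) = (∑' k, b k * y k) - (∑' k, b k) * l := by
  obtain ⟨B, hB⟩ := hy.norm.bddAbove_range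
  have hyB : ∀ k, ‖y k‖ ≤ B := fun k => hB ⟨k, rfl⟩
  simp only [mul_sub]
  rw [(summable_mul_of_bounded hb hyB).tsum_sub (hb.mul_right l), tsum_mul_right]

theorem fracMatrix_of_lt (α : ℝ) {n k : ℕ} (h : n < k) : fracMatrix α n k = 0 :=
  if_neg (by lia)

theorem sum_mul_fracDiff (α : ℝ) (a y : ℕ → ℂ) (M : ℕ) :
    ∑ k ∈ Finset.range M, a k * fracDiff α y k =
      ∑' j, (∑ k ∈ Finset.range M, fracMatrix α k j * a k) * y j := by
  rw [tsum_eq_sum (s := Finset.range M)]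
  · simp only [Finset.sum_mul]
    rw [Finset.sum_comm]
    refine Finset.sum_congr rfl fun k hk => ?_
    change a k * ∑ j ∈ Finset.range (k + 1), fracMatrix α k j * y j = _
    rw [Finset.mul_sum]
    refine (Finset.sum_subset (Finset.range_subset_range.2 (Finset.mem_range.1 hk))
      fun j _ hj => ?_).trans (Finset.sum_congr rfl fun j _ => by ring)
    rw [fracMatrix_of_lt α (by simpa using hj)]
    simp
  · intro j hj
    rw [Finset.sum_eq_zero, zero_mul]
    intro k hk
    rw [fracMatrix_of_lt α (by simp at hj hk; lia), zero_mul]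

theorem summable_sum_fracMatrix_mul (α : ℝ) (a : ℕ → ℂ) (M : ℕ) :
    Summable fun j => ∑ k ∈ Finset.range M, fracMatrix α k j * a k := by
  refine summable_of_ne_finset_zero (s := Finset.range M) fun j hj => ?_
  refine Finset.sum_eq_zero fun k hk => ?_
  rw [fracMatrix_of_lt α (by simp at hj hk; lia), zero_mul]

/-- The partial sums of the row series are finitely supported functionals `c M` of `y` that converge
pointwise on c. By uniform boundedness their ℓ¹ norms are bounded, so their coefficientwise limit
`â_n` is summable and gives the right value on null sequences. The constant sequence 1 accounts for
the rest, which is `γ_n`. -/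
theorem row_representation {α : ℝ} {A : ℕ → ℕ → ℂ} (hA : A ∈ MatrixClass (fracConv α) Set.univ)
    (n : ℕ) :
    (∀ k, Summable (fun j => fracMatrix (-α) j k * A n j) (SummationFilter.conditional ℕ)) ∧
    Summable (hatMatrix α A n) ∧
    Tendsto (fun m => ∑ k ∈ Finset.range (m + 1), wMatrix α A n m k) atTop
      (𝓝 (gammaSeq α A n)) ∧
    ∀ (y : ℕ → ℂ) (l : ℂ), Tendsto y atTop (𝓝 l) → matrixApply A (fracDiff (-α) y) n =
      (∑' k, hatMatrix α A n k * y k) - gammaSeq α A n * l := by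
  set c : ℕ → ℕ → ℂ := fun M j => ∑ k ∈ Finset.range M, fracMatrix (-α) k j * A n k with hc
  have hcs : ∀ M, Summable (c M) := fun M => summable_sum_fracMatrix_mul (-α) (A n) M
  have happ : ∀ (y : ℕ → ℂ) (l : ℂ), Tendsto y atTop (𝓝 l) →
      Tendsto (fun M => ∑' j, c M j * y j) atTop (𝓝 (matrixApply A (fracDiff (-α) y) n)) := by
    intro y l hy
    have h := ((hA _ (fracDiff_neg_mem_fracConv hy)).1 n).hasSum
    rw [hasSum_conditional_nat_iff] at h
    exact h.congr fun M => sum_mul_fracDiff (-α) (A n) y M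
  obtain ⟨C, hC⟩ := exists_bound_tsum_norm hcs fun y hy => by
    obtain ⟨C, hC⟩ := (happ y 0 hy).norm.bddAbove_range
    exact ⟨C, fun M => hC ⟨M, rfl⟩⟩
  have hsum : ∀ k, Summable (fun j => fracMatrix (-α) j k * A n j)
      (SummationFilter.conditional ℕ) := by
    intro k
    rw [summable_conditional_nat_iff]
    refine ⟨_, (happ (Pi.single k 1) 0 ?_).congr fun M => ?_⟩
    · refine tendsto_const_nhds.congr' ?_
      filter_upwards [eventually_gt_atTop k] with j hj
      rw [Pi.single_eq_of_ne (by lia)]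
    · rw [tsum_eq_single k fun j hj => by rw [Pi.single_eq_of_ne hj, mul_zero]]
      simp [hc]
  have hlim : ∀ k, Tendsto (fun M => c M k) atTop (𝓝 (hatMatrix α A n k)) := fun k =>
    hasSum_conditional_nat_iff.1 (hsum k).hasSum
  obtain ⟨hs, -⟩ := summable_of_tendsto_of_bound hcs hC hlim
  set L := matrixApply A (fracDiff (-α) 1) n with hL
  have h1 : Tendsto (fun M => ∑' j, c M j) atTop (𝓝 L) := by
    simpa using happ 1 1 tendsto_const_nhds
  -- `c m` sums the indices below m and `wMatrix` those from m on, so together they give the full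
  -- series.
  have hw : ∀ m k, k ≤ m → wMatrix α A n m k = hatMatrix α A n k - c m k := by
    intro m k hk
    rw [wMatrix, if_pos hk]
    refine HasSum.tsum_eq (hasSum_conditional_nat_iff.2 ?_)
    refine (((tendsto_add_atTop_iff_nat m).2 (hlim k)).sub_const (c m k)).congr fun N => ?_
    simp only [hc]
    rw [add_comm N m, Finset.sum_range_add, add_sub_cancel_left]
  have hg : Tendsto (fun m => ∑ k ∈ Finset.range (m + 1), wMatrix α A n m k) atTop
      (𝓝 ((∑' k, hatMatrix α A n k) - L)) := by
    refine (((tendsto_add_atTop_iff_nat 1).2 hs.hasSum.tendsto_sum_nat).sub h1).congr fun m => ?_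
    -- `c m` is supported below m, so its whole sum is already a sum over `range (m + 1)`.
    rw [tsum_eq_sum (s := Finset.range (m + 1)), ← Finset.sum_sub_distrib]
    · exact Finset.sum_congr rfl fun k hk => (hw m k (Nat.lt_succ_iff.1 (Finset.mem_range.1 hk))).symm
    · intro j hj
      refine Finset.sum_eq_zero fun k hk => ?_
      rw [fracMatrix_of_lt (-α) (by simp at hj hk; lia), zero_mul]
  have hgamma : gammaSeq α A n = (∑' k, hatMatrix α A n k) - L := hg.limUnder_eq
  refine ⟨hsum, hs, hgamma ▸ hg, fun y l hy => ?_⟩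
  have hy0 : Tendsto (fun k => y k - l) atTop (𝓝 0) := by simpa using hy.sub_const l
  have h2 := (happ y l hy).sub (h1.mul_const l)
  have h3 := tendsto_tsum_mul_of_bound hcs hC hlim hy0
  simp only [tsum_mul_sub_const (hcs _) hy, tsum_mul_sub_const hs hy] at h3
  have h4 := tendsto_nhds_unique h2 h3
  rw [hgamma]
  linear_combination h4

/-! ### The compactness criteria -/

theorem tsum_enorm_add_enorm {b : ℕ → ℂ} (hb : Summable b) (g : ℂ) :
    (∑' k, ‖b k‖ₑ) + ‖g‖ₑ = ENNReal.ofReal ((∑' k, ‖b k‖) + ‖g‖) := by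
  rw [ENNReal.ofReal_add (tsum_nonneg fun _ => norm_nonneg _) (norm_nonneg _),
    ENNReal.ofReal_tsum_of_nonneg (fun _ => norm_nonneg _) hb.norm]
  simp only [ofReal_norm]

/-- Each row is summable, so every term is a finite real number, although the suprema may be
infinite. -/
theorem tendsto_iSup_ge_tsum_enorm_iff {b : ℕ → ℕ → ℂ} (hb : ∀ n, Summable (b n)) (g : ℕ → ℂ) :
    Tendsto (fun r : ℕ => ⨆ n, ⨆ (_ : r ≤ n), ((∑' k, ‖b n k‖ₑ) + ‖g n‖ₑ)) atTop (𝓝 0) ↔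
      ∀ ε > 0, ∃ r : ℕ, ∀ n ≥ r, (∑' k, ‖b n k‖) + ‖g n‖ ≤ ε := by
  rw [ENNReal.tendsto_atTop_zero]
  simp only [tsum_enorm_add_enorm (hb _)]
  constructor
  · intro h ε hε
    obtain ⟨r, hr⟩ := h (ENNReal.ofReal ε) (ENNReal.ofReal_pos.2 hε)
    refine ⟨r, fun n hn => (ENNReal.ofReal_le_ofReal_iff hε.le).1 ?_⟩
    exact (le_iSup₂_of_le n hn le_rfl).trans (hr r le_rfl)
  · intro h ε hε
    obtain ⟨δ, hδ, hδε⟩ := ENNReal.lt_iff_exists_real_btwn.1 hε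
    have hδ0 : 0 < δ := ENNReal.ofReal_pos.1 hδε.1
    obtain ⟨r, hr⟩ := h δ hδ0
    refine ⟨r, fun s hs => iSup₂_le fun n hn => ?_⟩
    exact (ENNReal.ofReal_le_ofReal (hr n (le_trans hs hn))).trans hδε.2.le

theorem FracC.norm_fracDiff_le {α : ℝ} (x : FracC α) (k : ℕ) :
    ‖fracDiff α (FracC.toSeq α x) k‖ ≤ ‖x‖ :=
  lp.norm_apply_le_norm (by simp) (FracC.transform α x) k

/-- Surjectivity of the isometry onto the unit ball of c; it turns test sequences in c into vectors
of the domain. -/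
theorem FracC.exists_toSeq_eq {α : ℝ} {y : ℕ → ℂ} {l : ℂ} (hy : Tendsto y atTop (𝓝 l))
    (hy1 : ∀ k, ‖y k‖ ≤ 1) : ∃ x : FracC α, FracC.toSeq α x = fracDiff (-α) y ∧ ‖x‖ ≤ 1 := by
  let x : FracC α := (⟨fracDiff (-α) y, fracDiff_neg_mem_fracConv hy⟩ : ↥(fracConv α))
  refine ⟨x, rfl, (FracC.norm_eq x).trans_le ?_⟩
  refine ciSup_le fun k => ?_
  change ‖fracDiff α (fracDiff (-α) y) k‖ ≤ 1
  rw [fracDiff_fracDiff_neg]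
  exact hy1 k

section Criterion

variable {α : ℝ} {Y : Submodule ℂ EllInfty} {A : ℕ → ℕ → ℂ}

theorem MatrixClass.to_univ {X Z : Set (ℕ → ℂ)} (hA : A ∈ MatrixClass X Z) :
    A ∈ MatrixClass X Set.univ :=
  fun x hx => ⟨(hA x hx).1, trivial⟩

theorem matrixApply_sub_eq (hA : A ∈ MatrixClass (fracConv α) Set.univ) {h : ℕ → ℂ}
    (hh : Summable h) (d : ℂ) {y : ℕ → ℂ} {l : ℂ} (hy : Tendsto y atTop (𝓝 l)) (n : ℕ) :
    matrixApply A (fracDiff (-α) y) n - ((∑' k, h k * y k) - d * l) =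
      (∑' k, (hatMatrix α A n k - h k) * y k) - (gammaSeq α A n - d) * l := by
  obtain ⟨-, hs, -, hrep⟩ := row_representation hA n
  obtain ⟨B, hB⟩ := hy.norm.bddAbove_range
  have hyB : ∀ k, ‖y k‖ ≤ B := fun k => hB ⟨k, rfl⟩
  simp only [sub_mul]
  rw [hrep y l hy, (summable_mul_of_bounded hs hyB).tsum_sub (summable_mul_of_bounded hh hyB)]
  ring

/-- Coordinates n and r are both compared with the functional given by `h` and `d`. Only closedness
of `Y` is needed, so this also covers ℓ_∞. -/
theorem isCompactOperator_matrixOperator (hY : IsClosed (Y : Set EllInfty))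
    (hA : A ∈ MatrixClass (fracConv α) (seqs Y)) {h : ℕ → ℂ} (hh : Summable h) (d : ℂ)
    (hlim : ∀ ε > 0, ∃ r : ℕ, ∀ n ≥ r,
      (∑' k, ‖hatMatrix α A n k - h k‖) + ‖gammaSeq α A n - d‖ ≤ ε) :
    IsCompactOperator (matrixOperator hA) := by
  have hA' := MatrixClass.to_univ hA
  refine isCompactOperator_of_uniform_cauchy hY (fun n => ?_) fun ε hε => ?_
  · refine ⟨((∑' k, ‖hatMatrix α A n k‖) + ‖gammaSeq α A n‖) * 1, fun x hx => ?_⟩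
    obtain ⟨-, hs, -, hrep⟩ := row_representation hA' n
    obtain ⟨l, hl⟩ := FracC.toSeq_mem x
    rw [matrixOperator_apply, ← fracDiff_neg_fracDiff α (FracC.toSeq α x), hrep _ l hl]
    exact norm_tsum_mul_sub_le hs (fun k => (x.norm_fracDiff_le k).trans hx) hl
  · obtain ⟨r, hr⟩ := hlim (ε / 2) (by positivity)
    refine ⟨r, fun n hn x hx => ?_⟩
    obtain ⟨l, hl⟩ := FracC.toSeq_mem x
    have key : ∀ n ≥ r, ‖matrixApply A (FracC.toSeq α x) n -
        ((∑' k, h k * fracDiff α (FracC.toSeq α x) k) - d * l)‖ ≤ ε / 2 := by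
      intro n hn
      have hs := (row_representation hA' n).2.1
      have h1 := matrixApply_sub_eq hA' hh d hl n
      rw [fracDiff_neg_fracDiff] at h1
      rw [h1]
      refine (norm_tsum_mul_sub_le (hs.sub hh)
        (fun k => (x.norm_fracDiff_le k).trans hx) hl).trans ?_
      rw [mul_one]
      exact hr n hn
    rw [matrixOperator_apply, matrixOperator_apply]
    refine (norm_sub_le_norm_sub_add_norm_sub _
      ((∑' k, h k * fracDiff α (FracC.toSeq α x) k) - d * l) _).trans ?_
    rw [norm_sub_rev _ (matrixApply A (FracC.toSeq α x) r)]
    linarith [key n hn, key r le_rfl]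

/-- For necessity, compactness bounds the n-th coordinate minus its limit on the whole unit ball; by
`tsum_norm_add_norm_le` this bounds the norm of the difference functional. -/
theorem isCompactOperator_matrixOperator_iff (hY : IsClosed (Y : Set EllInfty)) (hYc : Y ≤ cSpace)
    (hA : A ∈ MatrixClass (fracConv α) (seqs Y)) {h : ℕ → ℂ} (hh : Summable h) (d : ℂ)
    (hlim : ∀ (y : ℕ → ℂ) (l : ℂ), Tendsto y atTop (𝓝 l) →
      Tendsto (matrixApply A (fracDiff (-α) y)) atTop (𝓝 ((∑' k, h k * y k) - d * l))) :
    IsCompactOperator (matrixOperator hA) ↔ ∀ ε > 0, ∃ r : ℕ, ∀ n ≥ r,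
      (∑' k, ‖hatMatrix α A n k - h k‖) + ‖gammaSeq α A n - d‖ ≤ ε := by
  refine ⟨fun hL ε hε => ?_, isCompactOperator_matrixOperator hY hA hh d⟩
  have hA' := MatrixClass.to_univ hA
  obtain ⟨r, hr⟩ := hL.uniform_tendsto hYc hε
  refine ⟨r, fun n hn => ?_⟩
  refine tsum_norm_add_norm_le ((row_representation hA' n).2.1.sub hh) fun y l hy hy1 => ?_
  obtain ⟨x, hx, hx1⟩ := FracC.exists_toSeq_eq (α := α) hy hy1
  have h1 := hr n hn x hx1 ((∑' k, h k * y k) - d * l) <| by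
    simp only [matrixOperator_apply, hx]
    exact hlim y l hy
  rwa [matrixOperator_apply, hx, matrixApply_sub_eq hA' hh d hy] at h1

/-- Unit vectors give `α̂_k`, the constant 1 gives `β`, and uniform boundedness on null sequences,
where the `γ_n` term vanishes, gives summability. Splitting `y` into `y - l` and the constant `l`
yields the limit functional. -/
theorem convergent_class_limits (hA : A ∈ MatrixClass (fracConv α) (seqs cSpace)) :
    (∀ k, Tendsto (fun n => hatMatrix α A n k) atTop (𝓝 (hatLimit α A k))) ∧
    Summable (hatLimit α A) ∧
    Tendsto (fun n => (∑' k, hatMatrix α A n k) - gammaSeq α A n) atTop (𝓝 (betaLimit α A)) ∧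
    ∀ (y : ℕ → ℂ) (l : ℂ), Tendsto y atTop (𝓝 l) →
      Tendsto (matrixApply A (fracDiff (-α) y)) atTop
        (𝓝 ((∑' k, hatLimit α A k * y k) - ((∑' k, hatLimit α A k) - betaLimit α A) * l)) := by
  have hA' := MatrixClass.to_univ hA
  have hs : ∀ n, Summable (hatMatrix α A n) := fun n => (row_representation hA' n).2.1
  have hrep := fun n => (row_representation hA' n).2.2.2
  have hconv : ∀ (y : ℕ → ℂ) (l : ℂ), Tendsto y atTop (𝓝 l) →
      ∃ m, Tendsto (fun n => (∑' k, hatMatrix α A n k * y k) - gammaSeq α A n * l) atTop (𝓝 m) := by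
    intro y l hy
    obtain ⟨m, hm⟩ := (mem_seqs_cSpace _).1 (hA _ (fracDiff_neg_mem_fracConv hy)).2
    exact ⟨m, hm.congr fun n => hrep n y l hy⟩
  have hhat : ∀ k, Tendsto (fun n => hatMatrix α A n k) atTop (𝓝 (hatLimit α A k)) := by
    intro k
    obtain ⟨m, hm⟩ := hconv (Pi.single k 1) 0 <| tendsto_const_nhds.congr' <| by
      filter_upwards [eventually_gt_atTop k] with j hj
      rw [Pi.single_eq_of_ne (by lia)]
    have hm' : Tendsto (fun n => hatMatrix α A n k) atTop (𝓝 m) := by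
      refine hm.congr fun n => ?_
      rw [tsum_eq_single k fun j hj => by rw [Pi.single_eq_of_ne hj, mul_zero]]
      simp
    rwa [hatLimit, hm'.limUnder_eq]
  have hbeta : Tendsto (fun n => (∑' k, hatMatrix α A n k) - gammaSeq α A n) atTop
      (𝓝 (betaLimit α A)) := by
    obtain ⟨m, hm⟩ := hconv 1 1 tendsto_const_nhds
    simp only [Pi.one_apply, mul_one] at hm
    rwa [betaLimit, hm.limUnder_eq]
  obtain ⟨C, hC⟩ := exists_bound_tsum_norm hs fun y hy => by
    obtain ⟨m, hm⟩ := hconv y 0 hy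
    obtain ⟨C, hC⟩ := hm.norm.bddAbove_range
    exact ⟨C, fun n => by simpa using hC ⟨n, rfl⟩⟩
  have hsl := (summable_of_tendsto_of_bound hs hC hhat).1
  refine ⟨hhat, hsl, hbeta, fun y l hy => ?_⟩
  have hy0 : Tendsto (fun k => y k - l) atTop (𝓝 0) := by simpa using hy.sub_const l
  have h1 := (tendsto_tsum_mul_of_bound hs hC hhat hy0).add (hbeta.mul_const l)
  rw [tsum_mul_sub_const hsl hy] at h1
  convert h1 using 1
  · funext n
    rw [hrep n y l hy, tsum_mul_sub_const (hs n) hy]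
    ring
  · congr 1
    ring

end Criterion

end

theorem mainTheorem3 (α : ℝ) :
    -- the series and limits that define `â` and `γ` converge
    (∀ A ∈ MatrixClass (fracConv α) Set.univ,
      (∀ n k, Summable (fun j => fracMatrix (-α) j k * A n j) (SummationFilter.conditional ℕ)) ∧
      (∀ n, Summable (hatMatrix α A n)) ∧
      (∀ n, Tendsto (fun m => ∑ k ∈ Finset.range (m + 1), wMatrix α A n m k) atTop
        (𝓝 (gammaSeq α A n)))) ∧
    -- (i) maps into the null sequences
    (∀ (A : ℕ → ℕ → ℂ) (hA : A ∈ MatrixClass (fracConv α) (seqs cZeroSpace)),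
      IsCompactOperator (matrixOperator hA) ↔
        Tendsto (fun r : ℕ => ⨆ n, ⨆ (_ : r ≤ n),
          ((∑' k, ‖hatMatrix α A n k‖ₑ) + ‖gammaSeq α A n‖ₑ)) atTop (𝓝 0)) ∧
    -- (ii) maps into the convergent sequences
    (∀ (A : ℕ → ℕ → ℂ) (hA : A ∈ MatrixClass (fracConv α) (seqs cSpace)),
      (∀ k, Tendsto (fun n => hatMatrix α A n k) atTop (𝓝 (hatLimit α A k))) ∧
      Summable (hatLimit α A) ∧
      Tendsto (fun n => (∑' k, hatMatrix α A n k) - gammaSeq α A n) atTop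
        (𝓝 (betaLimit α A)) ∧
      (IsCompactOperator (matrixOperator hA) ↔
        Tendsto (fun r : ℕ => ⨆ n, ⨆ (_ : r ≤ n),
          ((∑' k, ‖hatMatrix α A n k - hatLimit α A k‖ₑ) +
            ‖(∑' k, hatLimit α A k) - gammaSeq α A n - betaLimit α A‖ₑ)) atTop (𝓝 0))) ∧
    -- (iii) maps into the bounded sequences
    (∀ (A : ℕ → ℕ → ℂ) (hA : A ∈ MatrixClass (fracConv α) (seqs ⊤)),
      Tendsto (fun r : ℕ => ⨆ n, ⨆ (_ : r ≤ n),
        ((∑' k, ‖hatMatrix α A n k‖ₑ) + ‖gammaSeq α A n‖ₑ)) atTop (𝓝 0) →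
      IsCompactOperator (matrixOperator hA)) := by
  refine ⟨fun A hA => ?_, fun A hA => ?_, fun A hA => ?_, fun A hA h => ?_⟩
  · exact ⟨fun n => (row_representation hA n).1, fun n => (row_representation hA n).2.1,
      fun n => (row_representation hA n).2.2.1⟩
  · rw [tendsto_iSup_ge_tsum_enorm_iff
      (fun n => (row_representation (MatrixClass.to_univ hA) n).2.1),
      isCompactOperator_matrixOperator_iff isClosed_cZeroSpace (fun z hz => ⟨0, hz⟩) hA
        summable_zero 0 fun y l hy => ?_]
    · simp
    · simpa using (mem_seqs_cZeroSpace _).1 (hA _ (fracDiff_neg_mem_fracConv hy)).2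
  · obtain ⟨hhat, hsl, hbeta, hlim⟩ := convergent_class_limits hA
    refine ⟨hhat, hsl, hbeta, ?_⟩
    rw [tendsto_iSup_ge_tsum_enorm_iff
      (fun n => (row_representation (MatrixClass.to_univ hA) n).2.1.sub hsl),
      isCompactOperator_matrixOperator_iff isClosed_cSpace le_rfl hA hsl _ hlim]
    -- Here `d = ∑ α̂_k - β`, so `‖γ_n - d‖` is the last term of the criterion.
    simp only [norm_sub_rev (gammaSeq α A _), sub_right_comm _ (betaLimit α A)]
  · rw [tendsto_iSup_ge_tsum_enorm_iff
      (fun n => (row_representation (MatrixClass.to_univ hA) n).2.1)] at h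
    exact isCompactOperator_matrixOperator isClosed_univ hA summable_zero 0 (by simpa using h)
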